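/- Let $S=\{s_1,\dots,s_n\}$ be a finite partially ordered set and let $f_S(x_1,\dots,x_n)=\sum_{s_i\le s_j}x_ix_j$ be its quadratic form on $\mathbb R^n$ (the sum is over all pairs $(i,j)$ with $s_i\le s_j$, including $i=j$). Let $\Gamma(S)$ be the Hasse graph of $S$: the undirected graph with vertex set $S$ in which two elements are joined by an edge if and only if one of them is less than the other and no element of $S$ lies strictly between them. Call $S$ antimonotonous if there is no nonzero vector $h\in\mathbb R^n$ with $h_1+\dots+h_n=0$ such that either $\frac{\partial f_S}{\partial x_i}(h)\ge 0$ for all $i$, or $\frac{\partial f_S}{\partial x_i}(h)\le 0$ for all $i$. Suppose that $\Gamma(S)$ is connected (in particular $S\neq\varnothing$), that $S$ is antimonotonous, and that $f_S$ is positive semidefinite, i.e. $f_S(x)\ge 0$ for all $x\in\mathbb R^n$. Then $\Gamma(S)$ is isomorphic to $A_n$, the path graph on $n=|S|$ vertices. -/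

import Mathlib

open Classical in
/-- The `i`-th partial derivative `∂f/∂xᵢ` at the point `x`. -/
noncomputable def partialDeriv {ι : Type*} [Fintype ι] (f : (ι → ℝ) → ℝ) (i : ι)
    (x : ι → ℝ) : ℝ :=
  fderiv ℝ f x (Pi.single i 1)

/-- The nonzero vectors of the hyperplane `∑ xᵢ = 0`. -/
def hyperplaneNonzero (ι : Type*) [Fintype ι] : Set (ι → ℝ) :=
  {h | ∑ i, h i = 0 ∧ h ≠ 0}

/-- `C⁻(f)`: nonzero vectors of the hyperplane at which all partial derivatives are `≤ 0`. -/
def Cminus {ι : Type*} [Fintype ι] (f : (ι → ℝ) → ℝ) : Set (ι → ℝ) :=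
  {h | h ∈ hyperplaneNonzero ι ∧ ∀ i, partialDeriv f i h ≤ 0}

/-- `C⁺(f)`: nonzero vectors of the hyperplane at which all partial derivatives are `≥ 0`. -/
def Cplus {ι : Type*} [Fintype ι] (f : (ι → ℝ) → ℝ) : Set (ι → ℝ) :=
  {h | h ∈ hyperplaneNonzero ι ∧ ∀ i, 0 ≤ partialDeriv f i h}

/-- A (differentiable) function is antimonotonous if `C(f) = C⁺(f) ∪ C⁻(f)` is empty. -/
def Antimonotonous {ι : Type*} [Fintype ι] (f : (ι → ℝ) → ℝ) : Prop :=
  Cplus f ∪ Cminus f = ∅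

open Classical in
/-- The quadratic form `f_S(x) = ∑_{s ≤ t} x_s x_t` of a finite poset `S`; the sum is over all
ordered pairs `(s, t)` with `s ≤ t`, including `s = t`. -/
noncomputable def posetForm (S : Type*) [Fintype S] [PartialOrder S] (x : S → ℝ) : ℝ :=
  ∑ s : S, ∑ t : S, if s ≤ t then x s * x t else 0

/-- The form of a poset is differentiable, so its partial derivatives are the genuine ones. -/
theorem posetForm_differentiable (S : Type*) [Fintype S] [PartialOrder S] :
    Differentiable ℝ (posetForm S) := by
  unfold posetForm
  refine Differentiable.fun_sum fun s _ => Differentiable.fun_sum fun t _ => ?_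
  split_ifs <;> fun_prop

/-! Antimonotonicity upgrades semidefiniteness to definiteness, which rules out crowns; then
intervals are chains (`Antimonotonous.not_diamond`). So `coverDiff` inverts summation over principal
up-sets, and the substitution `x = coverDiff u` turns `posetForm` into the Tits form of the Hasse
graph (`posetForm_coverDiff`).

That form is definite on a connected graph, so it has a maximal positive root `z`
(`exists_maximal_root`), with nonnegative Cartan values satisfying `∑ z s * hasseCartan z s = 2`.
Either some `s` has `z s = 1` and positive Cartan value, or only one Cartan value is nonzero, equal
to 1 where `z = 2`. In the latter case `coverDiff z` is an integral vector whose gradient is the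
indicator of a principal up-set, contradicting `Antimonotonous.sum_ne_int`. In the former, `z` is
constantly 1, so `2 - degree` is nonnegative everywhere and positive at `s`: the graph is a path. -/

open Classical in
/-- The gradient of the poset form: `∂f_S/∂xᵢ = ∑_{t ≥ i} x_t + ∑_{t ≤ i} x_t`. -/
noncomputable def posetGrad {S : Type*} [Fintype S] [PartialOrder S] (x : S → ℝ) (i : S) : ℝ :=
  (∑ t, if i ≤ t then x t else 0) + ∑ t, if t ≤ i then x t else 0

/-! ### Gradient of the poset form and consequences of antimonotonicity. -/

section PosetForm

variable {S : Type*} [Fintype S] [PartialOrder S]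

open Classical in
theorem posetForm_eq_sum_mul (x : S → ℝ) :
    posetForm S x = ∑ s, x s * ∑ t, if s ≤ t then x t else 0 := by
  simp only [posetForm, Finset.mul_sum, mul_ite, mul_zero]

theorem posetForm_add (x y : S → ℝ) :
    posetForm S (x + y) = posetForm S x + ∑ i, y i * posetGrad x i + posetForm S y := by
  classical
  have h : ∑ i, y i * posetGrad x i =
      (∑ s, ∑ t, if s ≤ t then x s * y t else 0) + ∑ s, ∑ t, if s ≤ t then y s * x t else 0 := by
    simp only [posetGrad, mul_add, Finset.sum_add_distrib, Finset.mul_sum, mul_ite, mul_zero]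
    rw [add_comm]
    congr 1
    rw [Finset.sum_comm]
    simp only [mul_comm]
  rw [h]
  simp only [posetForm, ← Finset.sum_add_distrib]
  refine Finset.sum_congr rfl fun s _ => Finset.sum_congr rfl fun t _ => ?_
  split_ifs
  · simp only [Pi.add_apply]; ring
  · simp

theorem posetForm_single [DecidableEq S] (i : S) (c : ℝ) : posetForm S (Pi.single i c) = c ^ 2 := by
  rw [posetForm_eq_sum_mul, Finset.sum_eq_single i]
  · rw [Finset.sum_eq_single i]
    · simp [sq]
    · intro t _ ht
      simp [ht]
    · simp
  · intro t _ ht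
    simp [ht]
  · simp

theorem posetForm_add_single [DecidableEq S] (x : S → ℝ) (i : S) (c : ℝ) :
    posetForm S (x + Pi.single i c) = posetForm S x + c * posetGrad x i + c ^ 2 := by
  rw [posetForm_add, posetForm_single, Finset.sum_eq_single i]
  · simp
  · intro t _ ht
    simp [ht]
  · simp

theorem partialDeriv_posetForm (x : S → ℝ) (i : S) :
    partialDeriv (posetForm S) i x = posetGrad x i := by
  classical
  have hd := posetForm_differentiable S x
  have h1 : HasLineDerivAt ℝ (posetForm S) (posetGrad x i) x (Pi.single i 1) := by
    have h2 : HasDerivAt (fun c : ℝ => posetForm S x + c * posetGrad x i + c ^ 2)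
        (posetGrad x i) 0 := by
      have := (((hasDerivAt_id' (0 : ℝ)).mul_const (posetGrad x i)).const_add
        (posetForm S x)).fun_add (hasDerivAt_pow 2 (0 : ℝ))
      simpa using this
    refine h2.congr_of_eventuallyEq (Filter.Eventually.of_forall fun c => ?_)
    show posetForm S (x + c • Pi.single i 1) = posetForm S x + c * posetGrad x i + c ^ 2
    rw [← posetForm_add_single, ← Pi.single_smul, smul_eq_mul, mul_one]
  have h3 := hd.hasFDerivAt.hasLineDerivAt (Pi.single i 1)
  unfold partialDeriv
  convert h3.unique h1

theorem posetGrad_add (x y : S → ℝ) (i : S) :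
    posetGrad (x + y) i = posetGrad x i + posetGrad y i := by
  classical
  have h : ∀ p : Prop, ∀ t, (if p then (x + y) t else 0) =
      (if p then x t else 0) + (if p then y t else 0) := by
    intro p t; split_ifs <;> simp
  simp only [posetGrad, h, Finset.sum_add_distrib]
  ring

theorem posetGrad_smul (c : ℝ) (x : S → ℝ) (i : S) :
    posetGrad (c • x) i = c * posetGrad x i := by
  classical
  simp only [posetGrad, Pi.smul_apply, smul_eq_mul, mul_add, Finset.mul_sum, mul_ite, mul_zero]

open Classical in
theorem posetGrad_single [DecidableEq S] (j i : S) :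
    posetGrad (Pi.single j 1) i = (if i ≤ j then 1 else 0) + if j ≤ i then 1 else 0 := by
  unfold posetGrad
  congr 1
  · rw [Finset.sum_eq_single j]
    · simp
    · intro t _ ht
      simp [ht]
    · simp
  · rw [Finset.sum_eq_single j]
    · simp
    · intro t _ ht
      simp [ht]
    · simp

/-- Antimonotonicity of the poset form in terms of the explicit gradient. -/
theorem Antimonotonous.eq_zero_of_nonneg (hanti : Antimonotonous (posetForm S)) {h : S → ℝ}
    (hsum : ∑ i, h i = 0) (hg : ∀ i, 0 ≤ posetGrad h i) : h = 0 := by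
  by_contra hne
  have : h ∈ Cplus (posetForm S) ∪ Cminus (posetForm S) :=
    Or.inl ⟨⟨hsum, hne⟩, fun i => by rw [partialDeriv_posetForm]; exact hg i⟩
  rw [hanti] at this
  exact this

theorem Antimonotonous.eq_zero_of_nonpos (hanti : Antimonotonous (posetForm S)) {h : S → ℝ}
    (hsum : ∑ i, h i = 0) (hg : ∀ i, posetGrad h i ≤ 0) : h = 0 := by
  by_contra hne
  have : h ∈ Cplus (posetForm S) ∪ Cminus (posetForm S) :=
    Or.inr ⟨⟨hsum, hne⟩, fun i => by rw [partialDeriv_posetForm]; exact hg i⟩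
  rw [hanti] at this
  exact this

theorem posetGrad_single_nonneg [DecidableEq S] (j i : S) :
    0 ≤ posetGrad (Pi.single j 1) i := by
  rw [posetGrad_single]
  split_ifs <;> norm_num

theorem posetGrad_zero (i : S) : posetGrad (0 : S → ℝ) i = 0 := by
  simp [posetGrad]

/-- If the gradient of `h` is the indicator of a principal up-set then `∑ h` is no integer. -/
theorem Antimonotonous.sum_ne_int (hanti : Antimonotonous (posetForm S)) {h : S → ℝ} {s : S}
    (h2 : ∀ t, s ≤ t → posetGrad h t = 1) (h3 : ∀ t, ¬ s ≤ t → posetGrad h t = 0) (k : ℤ) : ∑ i, h i ≠ k := by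
  classical
  intro hk
  -- The gradient of `Pi.single s 1` is nonnegative, at least 1 above `s`, and 2 at `s`. So the
  -- gradient of `g` has one sign both for `k ≤ 0` and for `k ≥ 1`: integrality leaves no gap. Then
  -- `g = 0` would give `2 * k = 1`.
  set g : S → ℝ := h + (-(k : ℝ)) • Pi.single s 1 with hg
  have hsum : ∑ i, g i = 0 := by
    simp [hg, Finset.sum_add_distrib, Pi.single_apply, hk]
  have hgrad : ∀ i, posetGrad g i = posetGrad h i - k * posetGrad (Pi.single s 1) i := by
    intro i
    rw [hg, posetGrad_add, posetGrad_smul]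
    ring
  have hs : posetGrad (Pi.single s (1 : ℝ)) s = 2 := by
    rw [posetGrad_single]; norm_num
  have hgs := hgrad s
  rw [h2 s le_rfl, hs] at hgs
  have hz : g = 0 := by
    rcases le_or_gt k 0 with hk0 | hk0
    · have hk' : (k : ℝ) ≤ 0 := by exact_mod_cast hk0
      refine hanti.eq_zero_of_nonneg hsum fun i => ?_
      rw [hgrad]
      have := posetGrad_single_nonneg s i
      by_cases hi : s ≤ i
      · rw [h2 i hi]; nlinarith
      · rw [h3 i hi]; nlinarith
    · have hk' : (1 : ℝ) ≤ k := by exact_mod_cast hk0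
      refine hanti.eq_zero_of_nonpos hsum fun i => ?_
      rw [hgrad]
      by_cases hi : s ≤ i
      · have h5 : 1 ≤ posetGrad (Pi.single s (1 : ℝ)) i := by
          rw [posetGrad_single, if_pos hi]
          split_ifs <;> norm_num
        rw [h2 i hi]; nlinarith
      · have := posetGrad_single_nonneg s i
        rw [h3 i hi]; nlinarith
  rw [hz, posetGrad_zero] at hgs
  have : (2 * k : ℤ) = 1 := by
    have : (2 * k : ℝ) = 1 := by linarith
    exact_mod_cast this
  omega

/-- A positive semidefinite antimonotonous poset form is positive definite. -/
theorem Antimonotonous.eq_zero_of_posetForm_eq_zero (hanti : Antimonotonous (posetForm S))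
    (hpsd : ∀ x : S → ℝ, 0 ≤ posetForm S x) {x : S → ℝ} (hx : posetForm S x = 0) : x = 0 := by
  classical
  have hgrad : ∀ i, posetGrad x i = 0 := by
    intro i
    -- The minimum along axis `i`, where the form equals `-(posetGrad x i) ^ 2 / 4`.
    have := hpsd (x + Pi.single i (-(posetGrad x i) / 2))
    rw [posetForm_add_single, hx] at this
    nlinarith [sq_nonneg (posetGrad x i)]
  rcases isEmpty_or_nonempty S with hS | ⟨⟨s⟩⟩
  · exact Subsingleton.elim _ _
  set k := ∑ i, x i with hk
  set g : S → ℝ := x + (-k) • Pi.single s 1 with hg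
  have hsum : ∑ i, g i = 0 := by
    simp [hg, Finset.sum_add_distrib, Pi.single_apply, ← hk]
  have hgg : ∀ i, posetGrad g i = - k * posetGrad (Pi.single s 1) i := by
    intro i
    rw [hg, posetGrad_add, posetGrad_smul, hgrad, zero_add]
  have hz : g = 0 := by
    rcases le_total k 0 with hk0 | hk0
    · refine hanti.eq_zero_of_nonneg hsum fun i => ?_
      rw [hgg]
      exact mul_nonneg (by linarith) (posetGrad_single_nonneg s i)
    · refine hanti.eq_zero_of_nonpos hsum fun i => ?_
      rw [hgg]
      exact mul_nonpos_of_nonpos_of_nonneg (by linarith) (posetGrad_single_nonneg s i)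
  have hs : posetGrad (Pi.single s (1 : ℝ)) s = 2 := by
    rw [posetGrad_single]; norm_num
  have hk0 : k = 0 := by
    have := hgg s
    rw [hz, posetGrad_zero, hs] at this
    linarith
  simpa [hg, hk0] using hz

/-- Two incomparable elements below two incomparable elements: the form is not definite. -/
theorem not_crown (hpd : ∀ x : S → ℝ, posetForm S x = 0 → x = 0) {a b c d : S}
    (hac : a < c) (had : a < d) (hbc : b < c) (hbd : b < d)
    (hab : ¬ a ≤ b) (hba : ¬ b ≤ a) (hcd : ¬ c ≤ d) (hdc : ¬ d ≤ c) : False := by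
  classical
  -- Four squares cancel against four comparable pairs of opposite sign.
  have key := hpd (Pi.single a 1 + Pi.single b 1 + Pi.single c (-1) + Pi.single d (-1)) (by
    rw [posetForm_add_single, posetForm_add_single, posetForm_add_single, posetForm_single]
    have hneg : ∀ i : S, (Pi.single i (-1 : ℝ) : S → ℝ) = (-1 : ℝ) • Pi.single i 1 := by
      intro i; rw [← Pi.single_smul]; simp
    simp only [hneg, posetGrad_add, posetGrad_smul, posetGrad_single, hab, hba, hcd, hdc,
      hac.le, had.le, hbc.le, hbd.le, hac.not_ge, had.not_ge, hbc.not_ge, hbd.not_ge]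
    norm_num)
  have := congrFun key a
  simp [hac.ne, had.ne, show a ≠ b from fun h => hab h.le] at this

/-- Intervals of an antimonotonous poset with definite form are chains. -/
theorem Antimonotonous.not_diamond (hanti : Antimonotonous (posetForm S))
    (hpd : ∀ x : S → ℝ, posetForm S x = 0 → x = 0) {m a b M : S}
    (hma : m < a) (hmb : m < b) (haM : a < M) (hbM : b < M) : a ≤ b ∨ b ≤ a := by
  classical
  by_contra! hcon
  obtain ⟨hab, hba⟩ := hcon
  set h : S → ℝ := Pi.single m 1 + Pi.single M 1 + (-1 : ℝ) • Pi.single a 1 +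
    (-1 : ℝ) • Pi.single b 1 with hh
  have hsum : ∑ i, h i = 0 := by
    simp [hh, Finset.sum_add_distrib, Pi.single_apply]
  have hz : h = 0 := by
    refine hanti.eq_zero_of_nonneg hsum fun x => ?_
    simp only [hh, posetGrad_add, posetGrad_smul, posetGrad_single]
    have hmM := hma.trans haM
    have e1 : a ≤ x → m ≤ x := hma.le.trans
    have e2 : b ≤ x → m ≤ x := hmb.le.trans
    have e3 : x ≤ a → x ≤ M := fun h => h.trans haM.le
    have e4 : x ≤ b → x ≤ M := fun h => h.trans hbM.le
    have e5 : x ≤ a → b ≤ x → False := fun h h' => hba (h'.trans h)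
    have e6 : x ≤ b → a ≤ x → False := fun h h' => hab (h'.trans h)
    -- Otherwise `a, b` below `x, M` form a crown; `e10` is dual. These supply the second positive
    -- term where `a` and `b` both contribute `-1`.
    have e9 : a ≤ x → b ≤ x → x ≤ M ∨ M ≤ x := by
      intro h1 h2
      by_contra! h3
      exact not_crown hpd (lt_of_le_of_ne h1 (by rintro rfl; exact h3.1 haM.le)) haM
        (lt_of_le_of_ne h2 (by rintro rfl; exact h3.1 hbM.le)) hbM hab hba h3.1 h3.2
    have e10 : x ≤ a → x ≤ b → x ≤ m ∨ m ≤ x := by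
      intro h1 h2
      by_contra! h3
      exact not_crown hpd (lt_of_le_of_ne h1 (by rintro rfl; exact h3.2 hma.le))
        (lt_of_le_of_ne h2 (by rintro rfl; exact h3.2 hmb.le)) hma hmb h3.1 h3.2 hab hba
    have nn : ∀ p : Prop, (0 : ℝ) ≤ if p then 1 else 0 := fun p => by split_ifs <;> norm_num
    have mono : ∀ p q : Prop, (p → q) →
        (if p then (1 : ℝ) else 0) ≤ if q then 1 else 0 := fun p q hpq => by
      by_cases hp : p
      · simp [hp, hpq hp]
      · rw [if_neg hp]; exact nn q
    have or1 : ∀ p q : Prop, p ∨ q →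
        (1 : ℝ) ≤ (if p then 1 else 0) + if q then 1 else 0 := fun p q hpq => by
      rcases hpq with h | h
      · rw [if_pos h]; linarith [nn q]
      · rw [if_pos h]; linarith [nn p]
    have i1 := mono _ _ e1
    have i2 := mono _ _ e2
    have i3 := mono _ _ e3
    have i4 := mono _ _ e4
    have n1 := nn (x ≤ m)
    have n2 := nn (M ≤ x)
    by_cases p1 : a ≤ x <;> by_cases p2 : b ≤ x
    · have := or1 _ _ (e9 p1 p2)
      rw [if_neg fun h => e5 h p2, if_neg fun h => e6 h p1]
      rw [if_pos p1] at i1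
      rw [if_pos p1, if_pos p2]
      linarith
    · rw [if_neg fun h => e6 h p1, if_neg p2]
      linarith
    · rw [if_neg fun h => e5 h p2, if_neg p1]
      linarith
    · rw [if_neg p1, if_neg p2]
      have n3 := nn (m ≤ x)
      by_cases p3 : x ≤ a
      · by_cases p4 : x ≤ b
        · have := or1 _ _ (e10 p3 p4)
          rw [if_pos p3] at i3
          rw [if_pos p3, if_pos p4]
          linarith
        · rw [if_neg p4]
          linarith
      · rw [if_neg p3]
        linarith
  have := congrFun hz m
  simp [hh, hma.ne, hmb.ne, (hma.trans haM).ne] at this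

end PosetForm
-- Recognising path graphs.
namespace SimpleGraph

/-- A connected finite graph with all degrees at most two and a vertex of degree at most one is a
path. -/
theorem Connected.nonempty_iso_pathGraph {V : Type*} [Fintype V] {G : SimpleGraph V}
    (hG : G.Connected) {s : V} (hs : ∀ a b, G.Adj s a → G.Adj s b → a = b)
    (hdeg : ∀ v a b c, G.Adj v a → G.Adj v b → G.Adj v c → a = b ∨ b = c ∨ a = c) :
    Nonempty (G ≃g pathGraph (Fintype.card V)) := by
  classical
  have hpred : ∀ d v, G.dist s v = d + 1 → ∃ w, G.dist s w = d ∧ G.Adj w v := by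
    intro d v hd
    obtain ⟨p, hp⟩ := hG.exists_walk_length_eq_dist v s
    rw [G.dist_comm, hd] at hp
    cases p with
    | nil => simp at hp
    | @cons _ w _ hadj q =>
      have h1 : q.length = d := by simpa using hp
      have h2 := G.dist_le q
      have h3 := hG.dist_triangle (u := s) (v := w) (w := v)
      rw [dist_eq_one_iff_adj.mpr hadj.symm, hd] at h3
      rw [G.dist_comm] at h2
      exact ⟨w, by omega, hadj.symm⟩
  -- Spheres around `s` are singletons: beyond radius 1, the unique vertex of the previous sphere
  -- already spends one of its two edges going inward.
  have huniq : ∀ d v w, G.dist s v = d → G.dist s w = d → v = w := by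
    intro d
    induction d using Nat.strong_induction_on with
    | _ d ih =>
      intro v w hv hw
      match d with
      | 0 => rw [← (hG.dist_eq_zero_iff.mp hv), ← (hG.dist_eq_zero_iff.mp hw)]
      | 1 => exact hs v w (dist_eq_one_iff_adj.mp hv) (dist_eq_one_iff_adj.mp hw)
      | d + 2 =>
        obtain ⟨v', hv', hva⟩ := hpred _ _ hv
        obtain ⟨w', hw', hwa⟩ := hpred _ _ hw
        obtain rfl := ih (d + 1) (by omega) _ _ hv' hw'
        obtain ⟨x, hx, hxa⟩ := hpred _ _ hv'
        rcases hdeg v' v w x hva hwa hxa.symm with h | h | h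
        · exact h
        · subst h; omega
        · subst h; omega
  have hrange : ∀ d e v, e ≤ d → G.dist s v = d → ∃ w, G.dist s w = e := by
    intro d e
    induction d with
    | zero => intro v he hv; exact ⟨v, by omega⟩
    | succ d ih =>
      intro v he hv
      rcases Nat.lt_or_ge e (d + 1) with h | h
      · obtain ⟨w, hw, -⟩ := hpred _ _ hv
        exact ih w (by omega) hw
      · exact ⟨v, by omega⟩
  have hlt : ∀ v, G.dist s v < Fintype.card V := by
    intro v
    choose f hf using fun e : Fin (G.dist s v + 1) => hrange _ e v (by omega) rfl
    have hinj : Function.Injective f := by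
      intro a b hab
      apply Fin.ext
      rw [← hf a, ← hf b, hab]
    have := Fintype.card_le_of_injective f hinj
    simp only [Fintype.card_fin] at this
    omega
  let f : V → Fin (Fintype.card V) := fun v => ⟨G.dist s v, hlt v⟩
  have hf : Function.Bijective f := by
    rw [Fintype.bijective_iff_injective_and_card]
    refine ⟨fun v w h => ?_, by simp⟩
    exact huniq _ v w (congrArg Fin.val h) rfl
  have hstep : ∀ v w, G.dist s v + 1 = G.dist s w → G.Adj v w := by
    intro v w h
    obtain ⟨x, hx, hxa⟩ := hpred _ _ h.symm
    obtain rfl := huniq _ _ _ hx rfl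
    exact hxa
  refine ⟨⟨Equiv.ofBijective f hf, fun {v w} => ?_⟩⟩
  simp only [Equiv.ofBijective_apply, pathGraph_adj, f]
  constructor
  · rintro (h | h)
    · exact hstep v w h
    · exact (hstep w v h).symm
  · intro h
    have h1 := hG.dist_triangle (u := s) (v := v) (w := w)
    have h2 := hG.dist_triangle (u := s) (v := w) (w := v)
    rw [dist_eq_one_iff_adj.mpr h] at h1
    rw [dist_eq_one_iff_adj.mpr h.symm] at h2
    have h3 : G.dist s v ≠ G.dist s w := fun h' => h.ne (huniq _ _ _ h' rfl)
    omega

end SimpleGraph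

/-! ### The Tits form of the Hasse graph. -/

-- After exchanging the sums, each `u s` with `P s` and `s ≠ x` is subtracted exactly once, so only
-- `u x` survives.
open Classical in
theorem sum_sub_sum_eq {S : Type*} [Fintype S] {R : Type*} [CommRing R] {P : S → Prop}
    {c : S → S → Prop} {x : S} (hx : P x)
    (hc : ∀ s, P s → s ≠ x → ∃! t, P t ∧ c t s) (hc' : ∀ s t, P t → c t s → P s ∧ s ≠ x)
    (u : S → R) :
    (∑ t, if P t then u t - ∑ s, (if c t s then u s else 0) else 0) = u x := by
  have hcount : ∀ s, (∑ t, if P t ∧ c t s then u s else 0) = if P s ∧ s ≠ x then u s else 0 := by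
    intro s
    by_cases h : P s ∧ s ≠ x
    · obtain ⟨t, ht, huniq⟩ := hc s h.1 h.2
      rw [if_pos h, Finset.sum_eq_single t]
      · rw [if_pos ht]
      · intro b _ hb
        rw [if_neg fun hb' => hb (huniq b hb')]
      · simp
    · rw [if_neg h]
      refine Finset.sum_eq_zero fun t _ => if_neg fun ht => h (hc' s t ht.1 ht.2)
  have h1 : (∑ t, if P t then u t - ∑ s, (if c t s then u s else 0) else 0) =
      (∑ t, if P t then u t else 0) - ∑ t, ∑ s, if P t ∧ c t s then u s else 0 := by
    rw [← Finset.sum_sub_distrib]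
    refine Finset.sum_congr rfl fun t _ => ?_
    by_cases ht : P t <;> simp [ht]
  rw [h1, Finset.sum_comm, Finset.sum_congr rfl fun s _ => hcount s, ← Finset.sum_sub_distrib,
    Finset.sum_eq_single x]
  · simp [hx]
  · intro b _ hb
    simp [hb]
  · simp

section HasseForm

variable {S : Type*} [Fintype S] [PartialOrder S] {R : Type*} [CommRing R]

open Classical in
/-- `u_x - ∑ u_s` over the upper covers `s` of `x`. For a poset whose intervals are chains this is
the Möbius inverse of summation over principal up-sets. -/
noncomputable def coverDiff (u : S → R) (x : S) : R :=
  u x - ∑ s, if x ⋖ s then u s else 0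

open Classical in
/-- `2u_x - ∑ u_s` over the neighbours `s` of `x` in the Hasse graph. -/
noncomputable def hasseCartan (u : S → R) (x : S) : R :=
  2 * u x - (∑ s, if x ⋖ s then u s else 0) - ∑ s, if s ⋖ x then u s else 0

/-- The Tits form `∑ u_x² - ∑_{x ⋖ s} u_x u_s` of the Hasse graph. -/
noncomputable def hasseForm (u : S → R) : R := ∑ x, u x * coverDiff u x

theorem sum_mul_hasseCartan (u v : S → R) :
    ∑ x, v x * hasseCartan u x = (∑ x, v x * coverDiff u x) + ∑ x, u x * coverDiff v x := by
  classical
  have h : ∑ x, v x * (∑ s, if s ⋖ x then u s else 0) =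
      ∑ x, u x * (∑ s, if x ⋖ s then v s else 0) := by
    simp only [Finset.mul_sum, mul_ite, mul_zero]
    rw [Finset.sum_comm]
    simp only [mul_comm]
  simp only [hasseCartan, coverDiff, mul_sub, Finset.sum_sub_distrib]
  rw [h]
  have h2 : ∑ x, v x * (2 * u x) = (∑ x, v x * u x) + ∑ x, u x * v x := by
    rw [← Finset.sum_add_distrib]
    exact Finset.sum_congr rfl fun x _ => by ring
  rw [h2]
  ring

theorem sum_mul_hasseCartan_self (u : S → R) : ∑ x, u x * hasseCartan u x = 2 * hasseForm u := by
  rw [sum_mul_hasseCartan, hasseForm, two_mul]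

theorem coverDiff_add (u v : S → R) (x : S) :
    coverDiff (u + v) x = coverDiff u x + coverDiff v x := by
  classical
  simp only [coverDiff, Pi.add_apply, ite_add_zero, Finset.sum_add_distrib]
  ring

theorem hasseForm_add (u v : S → R) :
    hasseForm (u + v) = hasseForm u + ∑ x, v x * hasseCartan u x + hasseForm v := by
  rw [sum_mul_hasseCartan]
  simp only [hasseForm, coverDiff_add, Pi.add_apply, add_mul, mul_add, Finset.sum_add_distrib]
  ring

theorem hasseForm_single [DecidableEq S] (s : S) : hasseForm (Pi.single s (1 : R)) = 1 := by
  classical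
  rw [hasseForm, Finset.sum_eq_single s]
  · rw [coverDiff, Finset.sum_eq_zero, Pi.single_eq_same]
    · ring
    · intro t _
      split_ifs with h
      · simp [h.lt.ne']
      · rfl
  · intro t _ ht
    simp [ht]
  · simp

theorem hasseForm_add_single [DecidableEq S] (u : S → R) (s : S) :
    hasseForm (u + Pi.single s 1) = hasseForm u + hasseCartan u s + 1 := by
  rw [hasseForm_add, hasseForm_single, Finset.sum_eq_single s]
  · simp
  · intro t _ ht
    simp [ht]
  · simp

/-- `hasseCartan` as a linear endomorphism. -/
noncomputable def hasseCartanLin (S : Type*) [Fintype S] [PartialOrder S] :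
    (S → ℝ) →ₗ[ℝ] (S → ℝ) where
  toFun := hasseCartan
  map_add' u v := by
    classical
    funext x
    simp only [hasseCartan, Pi.add_apply, ite_add_zero, Finset.sum_add_distrib]
    ring
  map_smul' c u := by
    classical
    funext x
    simp only [hasseCartan, Pi.smul_apply, smul_eq_mul, mul_sub, Finset.mul_sum, mul_ite,
      mul_zero, RingHom.id_apply]
    ring_nf

theorem coverDiff_intCast (z : S → ℤ) (x : S) :
    coverDiff (fun s => (z s : ℝ)) x = (coverDiff z x : ℤ) := by
  classical
  simp [coverDiff]

theorem hasseCartan_intCast (z : S → ℤ) (x : S) :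
    hasseCartan (fun s => (z s : ℝ)) x = (hasseCartan z x : ℤ) := by
  classical
  simp [hasseCartan]

theorem hasseForm_intCast (z : S → ℤ) :
    hasseForm (fun s => (z s : ℝ)) = (hasseForm z : ℤ) := by
  simp [hasseForm, coverDiff_intCast]

open Classical in
theorem hasseCartan_eq_sub_sum_neighborFinset (u : S → R) (x : S) :
    hasseCartan u x = 2 * u x - ∑ s ∈ (SimpleGraph.hasse S).neighborFinset x, u s := by
  have h : ∑ s ∈ (SimpleGraph.hasse S).neighborFinset x, u s =
      (∑ s, if x ⋖ s then u s else 0) + ∑ s, if s ⋖ x then u s else 0 := by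
    rw [← Finset.sum_add_distrib, SimpleGraph.neighborFinset_eq_filter, Finset.sum_filter]
    refine Finset.sum_congr rfl fun s _ => ?_
    rw [SimpleGraph.hasse_adj]
    by_cases h1 : x ⋖ s
    · have h2 : ¬ s ⋖ x := fun h2 => h1.lt.not_gt h2.lt
      simp [h1, h2]
    · simp [h1]
  rw [h, hasseCartan]
  ring

open Classical in
theorem hasseCartan_one (x : S) :
    hasseCartan (1 : S → ℤ) x = 2 - (SimpleGraph.hasse S).degree x := by
  rw [hasseCartan_eq_sub_sum_neighborFinset]
  simp

/-- The value is vertices minus edges, and a connected graph contains a spanning tree. -/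
theorem hasseForm_one_le (hconn : (SimpleGraph.hasse S).Connected) :
    hasseForm (1 : S → ℤ) ≤ 1 := by
  classical
  have h1 := sum_mul_hasseCartan_self (1 : S → ℤ)
  simp only [hasseCartan_one, Pi.one_apply, one_mul, Finset.sum_sub_distrib] at h1
  have h2 := (SimpleGraph.hasse S).sum_degrees_eq_twice_card_edges
  have h3 := hconn.card_vert_le_card_edgeSet_add_one
  rw [Nat.card_eq_fintype_card, Nat.card_eq_fintype_card, ← SimpleGraph.edgeFinset_card] at h3
  rw [← Nat.cast_sum, h2] at h1
  simp at h1
  omega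

/-! ### Möbius inversion when intervals are chains. -/

variable (hI : ∀ m a b M : S, m < a → m < b → a < M → b < M → a ≤ b ∨ b ≤ a)

section
include hI

theorem existsUnique_le_covBy {x s : S} (hxs : x < s) : ∃! t, x ≤ t ∧ t ⋖ s := by
  obtain ⟨t, hxt, hts⟩ := exists_le_covBy_of_lt hxs
  refine ⟨t, ⟨hxt, hts⟩, fun t' ⟨hxt', hts'⟩ => ?_⟩
  have key : ∀ a b : S, a ⋖ s → b ⋖ s → a ≤ b → a = b := fun a b ha hb hab =>
    hab.eq_or_lt.resolve_right fun h => ha.2 h hb.lt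
  rcases hxt.eq_or_lt with rfl | h1
  · exact (key _ _ hts hts' hxt').symm
  · rcases hxt'.eq_or_lt with rfl | h2
    · exact key _ _ hts' hts hxt
    · rcases hI x t t' s h1 h2 hts.lt hts'.lt with h | h
      · exact (key _ _ hts hts' h).symm
      · exact key _ _ hts' hts h

theorem existsUnique_covBy_le {x s : S} (hsx : s < x) : ∃! t, t ≤ x ∧ s ⋖ t := by
  obtain ⟨t, hst, htx⟩ := exists_covBy_le_of_lt hsx
  refine ⟨t, ⟨htx, hst⟩, fun t' ⟨htx', hst'⟩ => ?_⟩
  have key : ∀ a b : S, s ⋖ a → s ⋖ b → a ≤ b → a = b := fun a b ha hb hab =>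
    hab.eq_or_lt.resolve_right fun h => hb.2 ha.lt h
  rcases htx.eq_or_lt with rfl | h1
  · exact key _ _ hst' hst htx'
  · rcases htx'.eq_or_lt with rfl | h2
    · exact (key _ _ hst hst' htx).symm
    · rcases hI s t t' x hst.lt hst'.lt h1 h2 with h | h
      · exact (key _ _ hst hst' h).symm
      · exact key _ _ hst' hst h

open Classical in
theorem sum_coverDiff (u : S → R) (x : S) :
    (∑ t, if x ≤ t then coverDiff u t else 0) = u x := by
  simp only [coverDiff]
  exact sum_sub_sum_eq (P := fun t => x ≤ t) (c := fun t s => t ⋖ s) le_rfl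
    (fun s h1 h2 => existsUnique_le_covBy hI (lt_of_le_of_ne h1 h2.symm))
    (fun s t h1 h2 => ⟨h1.trans h2.le, (h1.trans_lt h2.lt).ne'⟩) u

-- The up-set half of the gradient collapses to `u x`; the dual inversion rewrites this as a
-- down-set sum, which merges with the other half into Cartan values.
open Classical in
theorem posetGrad_coverDiff (u : S → ℝ) (x : S) :
    posetGrad (coverDiff u) x = ∑ t, if t ≤ x then hasseCartan u t else 0 := by
  have h1 : (∑ t, if t ≤ x then (u t - ∑ s, if s ⋖ t then u s else 0) else 0) = u x :=
    sum_sub_sum_eq (P := fun t => t ≤ x) (c := fun t s => s ⋖ t) le_rfl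
      (fun s h1 h2 => existsUnique_covBy_le hI (lt_of_le_of_ne h1 h2))
      (fun s t h1 h2 => ⟨h2.le.trans h1, (h2.lt.trans_le h1).ne⟩) u
  rw [posetGrad, sum_coverDiff hI]
  nth_rewrite 1 [← h1]
  rw [← Finset.sum_add_distrib]
  refine Finset.sum_congr rfl fun t _ => ?_
  split_ifs
  · rw [hasseCartan, coverDiff]; ring
  · simp

theorem posetForm_coverDiff (u : S → ℝ) : posetForm S (coverDiff u) = hasseForm u := by
  classical
  rw [posetForm_eq_sum_mul, hasseForm]
  refine Finset.sum_congr rfl fun s _ => ?_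
  have := sum_coverDiff hI u s
  rw [mul_comm]
  congr 1

theorem eq_zero_of_hasseForm_eq_zero (hpd : ∀ x : S → ℝ, posetForm S x = 0 → x = 0) {u : S → ℝ}
    (hu : hasseForm u = 0) : u = 0 := by
  classical
  have h := hpd (coverDiff u) (by rw [posetForm_coverDiff hI, hu])
  funext x
  rw [← sum_coverDiff hI u x, h]
  simp

end

end HasseForm

/-! ### Maximal positive roots. -/

section

variable {S : Type*} [Fintype S] [PartialOrder S]

/-- A definite Hasse form of a connected Hasse graph has a maximal positive root. -/
theorem exists_maximal_root (hconn : (SimpleGraph.hasse S).Connected)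
    (hnn : ∀ u : S → ℝ, 0 ≤ hasseForm u) (hpd : ∀ u : S → ℝ, hasseForm u = 0 → u = 0) :
    ∃ z : S → ℤ, (∀ s, 1 ≤ z s) ∧ hasseForm z = 1 ∧ ∀ s, 0 ≤ hasseCartan z s := by
  classical
  have hpos : ∀ z : S → ℤ, (∀ s, 1 ≤ z s) → 1 ≤ hasseForm z := by
    intro z hz
    have h0 : (0 : ℝ) ≤ (hasseForm z : ℤ) := by rw [← hasseForm_intCast]; exact hnn _
    have h1 : (0 : ℤ) ≤ hasseForm z := by exact_mod_cast h0
    have h2 : hasseForm z ≠ 0 := by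
      intro h
      have := hpd (fun s => (z s : ℝ)) (by rw [hasseForm_intCast, h, Int.cast_zero])
      obtain ⟨s⟩ := hconn.nonempty
      have h3 : (z s : ℝ) = 0 := congrFun this s
      have h4 : z s = 0 := by exact_mod_cast h3
      have := hz s
      omega
    omega
  -- For a root `z`, expanding `0 ≤ hasseForm (g + z)` gives `∑ z ≤ hasseForm g + 1`, so coordinate
  -- sums are bounded and a maximum exists.
  obtain ⟨g, hg⟩ : ∃ g : S → ℝ, hasseCartanLin S g = fun _ => -1 := by
    refine (LinearMap.injective_iff_surjective.mp ?_) _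
    rw [injective_iff_map_eq_zero]
    intro u hu
    apply hpd
    have h1 := sum_mul_hasseCartan_self u
    have h2 : ∀ x, hasseCartan u x = 0 := fun x => congrFun hu x
    simp only [h2, mul_zero, Finset.sum_const_zero] at h1
    linarith
  have hbound : ∀ z : S → ℤ, hasseForm z = 1 → ∑ s, z s ≤ ⌊hasseForm g + 1⌋ := by
    intro z hz
    rw [Int.le_floor]
    have h1 := hnn (g + fun s => (z s : ℝ))
    have h2 : ∀ x, hasseCartan g x = -1 := fun x => congrFun hg x
    rw [hasseForm_add, hasseForm_intCast, hz] at h1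
    simp only [h2, mul_neg, mul_one, Finset.sum_neg_distrib] at h1
    push_cast at h1 ⊢
    linarith
  obtain ⟨k, ⟨z, hz1, hz2, hzk⟩, hmax⟩ := Int.exists_greatest_of_bdd
    (P := fun k => ∃ z : S → ℤ, (∀ s, 1 ≤ z s) ∧ hasseForm z = 1 ∧ ∑ s, z s = k)
    ⟨⌊hasseForm g + 1⌋, by rintro k ⟨z, -, hz, rfl⟩; exact hbound z hz⟩
    ⟨_, 1, fun s => le_rfl, le_antisymm (hasseForm_one_le hconn) (hpos _ fun s => le_rfl), rfl⟩
  refine ⟨z, hz1, hz2, fun s => ?_⟩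
  -- With a Cartan value at most `-1`, adding `Pi.single s 1` does not increase the form, so it
  -- yields a positive root with larger sum.
  by_contra! hs
  have hz' : ∀ t, 1 ≤ (z + Pi.single s 1 : S → ℤ) t := by
    intro t
    have := hz1 t
    rw [Pi.add_apply, Pi.single_apply]
    split_ifs <;> omega
  have h1 := hpos _ hz'
  have h2 := hasseForm_add_single z s
  have h3 := hmax _ ⟨z + Pi.single s 1, hz', by omega, rfl⟩
  simp [Finset.sum_add_distrib, hzk] at h3

theorem sum_le_of_hasseCartan {z : S → ℤ} (hz : ∀ s, 1 ≤ z s) {v w : S}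
    (hw : (SimpleGraph.hasse S).Adj v w) : z w ≤ 2 * z v - hasseCartan z v ∧
      ∀ w', (SimpleGraph.hasse S).Adj v w' → w' ≠ w → z w + z w' ≤ 2 * z v - hasseCartan z v := by
  classical
  have h := hasseCartan_eq_sub_sum_neighborFinset z v
  have hnn : ∀ s ∈ (SimpleGraph.hasse S).neighborFinset v, 0 ≤ z s := fun s _ => by
    have := hz s; omega
  have hmem : w ∈ (SimpleGraph.hasse S).neighborFinset v := by simpa using hw
  refine ⟨?_, fun w' hw' hne => ?_⟩
  · have := Finset.single_le_sum hnn hmem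
    omega
  · have hsub : ({w, w'} : Finset S) ⊆ (SimpleGraph.hasse S).neighborFinset v := by
      intro x hx
      rcases Finset.mem_insert.mp hx with rfl | hx
      · exact hmem
      · rw [Finset.mem_singleton.mp hx]; simpa using hw'
    have := Finset.sum_le_sum_of_subset_of_nonneg hsub fun s hs _ => hnn s hs
    rw [Finset.sum_pair hne.symm] at this
    omega

/-- A positive root equal to `1` where its Cartan value is positive is constant. -/
theorem eq_one_of_hasseCartan (hconn : (SimpleGraph.hasse S).Connected) {z : S → ℤ}
    (hz : ∀ s, 1 ≤ z s) (hC : ∀ s, 0 ≤ hasseCartan z s) {s : S} (hs : z s = 1)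
    (hCs : 1 ≤ hasseCartan z s) : z = 1 := by
  -- Where `z v = 1`, the neighbours sum to `2 - hasseCartan z v`. A positive Cartan value, or a
  -- neighbour already equal to 1, leaves at most 1 for any other neighbour.
  have key : ∀ v, Relation.ReflTransGen (SimpleGraph.hasse S).Adj s v → z v = 1 ∧
      (1 ≤ hasseCartan z v ∨ ∃ w, (SimpleGraph.hasse S).Adj v w ∧ z w = 1) := by
    intro v hv
    induction hv with
    | refl => exact ⟨hs, Or.inl hCs⟩
    | @tail v w _ hvw ih =>
      obtain ⟨hv1, hv2⟩ := ih
      have hw := hz w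
      have h1 : z w = 1 := by
        obtain ⟨h3, h4⟩ := sum_le_of_hasseCartan hz hvw
        rcases hv2 with h | ⟨w', hw', hw1⟩
        · omega
        · by_cases hne : w' = w
          · rw [← hne, hw1]
          · have := h4 w' hw' hne
            have := hC v
            omega
      exact ⟨h1, Or.inr ⟨v, hvw.symm, hv1⟩⟩
  funext v
  exact (key v ((SimpleGraph.reachable_iff_reflTransGen s v).mp (hconn s v))).1

end

/-! ### The main theorem. -/

theorem proposition6 (S : Type*) [Fintype S] [PartialOrder S]
    (hconn : (SimpleGraph.hasse S).Connected)
    (hanti : Antimonotonous (posetForm S))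
    (hpsd : ∀ x : S → ℝ, 0 ≤ posetForm S x) :
    Nonempty (SimpleGraph.hasse S ≃g SimpleGraph.pathGraph (Fintype.card S)) := by
  classical
  have hpd : ∀ x : S → ℝ, posetForm S x = 0 → x = 0 := fun x hx =>
    hanti.eq_zero_of_posetForm_eq_zero hpsd hx
  have hI : ∀ m a b M : S, m < a → m < b → a < M → b < M → a ≤ b ∨ b ≤ a :=
    fun m a b M h1 h2 h3 h4 => hanti.not_diamond hpd h1 h2 h3 h4
  obtain ⟨z, hz, hform, hC⟩ := exists_maximal_root hconn
    (fun u => by rw [← posetForm_coverDiff hI]; exact hpsd _)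
    (fun u hu => eq_zero_of_hasseForm_eq_zero hI hpd hu)
  have hsum := sum_mul_hasseCartan_self z
  rw [hform] at hsum
  have hnn : ∀ s ∈ Finset.univ, 0 ≤ z s * hasseCartan z s := fun s _ =>
    mul_nonneg (by linarith [hz s]) (hC s)
  obtain ⟨s, hCs⟩ : ∃ s, 1 ≤ hasseCartan z s := by
    by_contra! hcon
    rw [Finset.sum_eq_zero fun s _ => by rw [le_antisymm (by linarith [hcon s]) (hC s), mul_zero]]
      at hsum
    omega
  have hzs : z s = 1 := by
    by_contra hne
    -- The term at `s` alone then exhausts the total 2, so all other Cartan values vanish.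
    have h2 : 2 ≤ z s := by have := hz s; omega
    have hle := Finset.single_le_sum hnn (Finset.mem_univ s)
    rw [hsum] at hle
    have hCs1 : hasseCartan z s = 1 := by nlinarith
    have hzs2 : z s = 2 := by rw [hCs1] at hle; omega
    have hC0 : ∀ t, t ≠ s → hasseCartan z t = 0 := by
      intro t hts
      have := Finset.sum_le_sum_of_subset_of_nonneg (Finset.subset_univ {s, t})
        fun i hi _ => hnn i hi
      rw [Finset.sum_pair hts.symm, hsum, hCs1, hzs2] at this
      have h1 := hz t
      have h3 := hC t
      nlinarith
    have hgrad : ∀ x, posetGrad (coverDiff fun i => (z i : ℝ)) x = if s ≤ x then 1 else 0 := by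
      intro x
      rw [posetGrad_coverDiff hI, Finset.sum_eq_single s]
      · rw [hasseCartan_intCast, hCs1, Int.cast_one]
      · intro t _ hts
        rw [hasseCartan_intCast, hC0 t hts]
        simp
      · simp
    refine hanti.sum_ne_int (s := s)
      (fun t ht => by rw [hgrad, if_pos ht]) (fun t ht => by rw [hgrad, if_neg ht])
      (∑ i, coverDiff z i) ?_
    simp only [coverDiff_intCast, Int.cast_sum]
  obtain rfl := eq_one_of_hasseCartan hconn hz hC hzs hCs
  simp only [hasseCartan_one] at hC hCs
  refine hconn.nonempty_iso_pathGraph (s := s) (fun a b ha hb => ?_) (fun v a b c ha hb hc => ?_)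
  · by_contra hab
    have hsub : ({a, b} : Finset S) ⊆ (SimpleGraph.hasse S).neighborFinset s := by
      intro x hx
      simp only [Finset.mem_insert, Finset.mem_singleton] at hx
      rcases hx with rfl | rfl <;> simpa
    have := Finset.card_le_card hsub
    rw [Finset.card_pair hab, SimpleGraph.card_neighborFinset_eq_degree] at this
    omega
  · by_contra! hcon
    have hsub : ({a, b, c} : Finset S) ⊆ (SimpleGraph.hasse S).neighborFinset v := by
      intro x hx
      simp only [Finset.mem_insert, Finset.mem_singleton] at hx
      rcases hx with rfl | rfl | rfl <;> simpa
    have := Finset.card_le_card hsub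
    have hv := hC v
    rw [Finset.card_eq_three.mpr ⟨a, b, c, hcon.1, hcon.2.2, hcon.2.1, rfl⟩,
      SimpleGraph.card_neighborFinset_eq_degree] at this
    omega
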